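/- Let $n\ge 3$ and let $S^2(\mathbb{C}^n)$ be the space of symmetric complex $n\times n$ matrices, with coordinates $x_{i,j}=x_{j,i}$ ($1\le i\le j\le n$). Let $L_{C_n}\subset S^2(\mathbb{C}^n)$ be the space of matrices $K$ with $K_{i,j}=0$ whenever $i\ne j$ and $i,j$ are not neighbours in the $n$-cycle $C_n$, let $L_{C_n}^{\perp}$ be its orthogonal complement in $S^2(\mathbb{C}^n)$ with respect to the trace pairing $(A,B)\mapsto\operatorname{tr}(AB)$ (the symmetric matrices that vanish on the diagonal and on the edges of $C_n$), and let $L_{C_n}^{-1}$ be the Zariski closure of $\{K^{-1} : K\in L_{C_n},\ \det K\neq 0\}$ in $S^2(\mathbb{C}^n)$. Let $I$ and $I'$ be the ideals of all polynomials in the $x_{i,j}$ that vanish on $L_{C_n}^{-1}$ and on $\mathrm{Id}+L_{C_n}^{\perp}$, respectively, so that $I+I'$ defines the scheme-theoretic intersection. Then every point $A$ of $L_{C_n}^{-1}\cap(\mathrm{Id}+L_{C_n}^{\perp})$ is a smooth (reduced, isolated) point of the intersection, and the intersection is transverse at $A$. That is: 1. the Jacobian matrix of $I+I'$ at $A$ has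 full rank $\binom{n+1}{2}$: the gradients at $A$ of the polynomials in $I+I'$ span the whole space of dimension $\binom{n+1}{2}$; 2. the Zariski tangent space $T_A L_{C_n}^{-1}$ (the vectors annihilated by the gradients at $A$ of all polynomials in $I$) has dimension $2n$, which is the dimension of $L_{C_n}^{-1}$, and $S^2(\mathbb{C}^n)=T_A L_{C_n}^{-1}\oplus T_A(\mathrm{Id}+L_{C_n}^{\perp})$; 3. the local ring at $A$ of the scheme defined by $I+I'$ is reduced, and $A$ is an isolated point of $L_{C_n}^{-1}\cap(\mathrm{Id}+L_{C_n}^{\perp})$ in the Zariski topology. -/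

import Mathlib

open MvPolynomial

noncomputable section

/-- A symmetric matrix is stored through its entries `x_{i,j} = x_{j,i}`, one coordinate for each
unordered pair: the vector space of symmetric `V × V` matrices is `Sym2 V → ℂ`, of dimension
`(|V| + 1).choose 2`. This is the matrix with the given entries. -/
def symMatrix {V : Type*} (x : Sym2 V → ℂ) : Matrix V V ℂ :=
  Matrix.of fun i j => x s(i, j)

theorem symMatrix_isSymm {V : Type*} (x : Sym2 V → ℂ) : (symMatrix x).IsSymm := by
  ext i j
  simp [symMatrix, Sym2.eq_swap]

/-- Every symmetric matrix has exactly one coordinate vector. -/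
theorem existsUnique_symMatrix {V : Type*} (M : Matrix V V ℂ) (hM : M.IsSymm) :
    ∃! x : Sym2 V → ℂ, symMatrix x = M := by
  refine ⟨fun e => Sym2.lift ⟨fun i j => M i j, fun i j => (hM.apply i j).symm⟩ e, ?_, ?_⟩
  · ext i j
    simp [symMatrix]
  · intro y hy
    funext e
    induction e using Sym2.ind with
    | _ i j => simp [← hy, symMatrix]

/-- The space `L_G` of symmetric matrices `A` with `A i j = 0` whenever `i ≠ j` and `i`, `j` are
not adjacent in the graph `G`. -/
def modelSpace {V : Type*} (G : SimpleGraph V) : Submodule ℂ (Sym2 V → ℂ) where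
  carrier := {x | ∀ i j, i ≠ j → ¬ G.Adj i j → symMatrix x i j = 0}
  zero_mem' := fun i j _ _ => by simp [symMatrix]
  add_mem' := fun {x y} hx hy i j h h' => by
    have h1 := hx i j h h'
    have h2 := hy i j h h'
    simp only [symMatrix, Matrix.of_apply] at h1 h2
    simp [symMatrix, h1, h2]
  smul_mem' := fun c x hx i j h h' => by
    have h1 := hx i j h h'
    simp only [symMatrix, Matrix.of_apply] at h1
    simp [symMatrix, h1]

/-- The orthogonal complement `L_G^⊥` of `L_G` in the space of symmetric matrices, for the trace
pairing `(A, B) ↦ tr (A B)`. -/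
def modelPerp {V : Type*} [Fintype V] (G : SimpleGraph V) : Submodule ℂ (Sym2 V → ℂ) where
  carrier := {y | ∀ x ∈ modelSpace G, (symMatrix x * symMatrix y).trace = 0}
  zero_mem' := fun x _ => by simp [symMatrix, Matrix.trace, Matrix.mul_apply]
  add_mem' := fun {y z} hy hz x hx => by
    have h : symMatrix (y + z) = symMatrix y + symMatrix z := by ext; simp [symMatrix]
    rw [h, Matrix.mul_add, Matrix.trace_add, hy x hx, hz x hx, add_zero]
  smul_mem' := fun c y hy x hx => by
    have h : symMatrix (c • y) = c • symMatrix y := by ext; simp [symMatrix]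
    rw [h, Matrix.mul_smul, Matrix.trace_smul, hy x hx, smul_zero]

/-- `L_G^⊥` consists of the symmetric matrices that vanish on the diagonal and on the edges. -/
theorem mem_modelPerp_iff {V : Type*} [Fintype V] (G : SimpleGraph V) (y : Sym2 V → ℂ) :
    y ∈ modelPerp G ↔ ∀ i j, i = j ∨ G.Adj i j → symMatrix y i j = 0 := by
  classical
  constructor
  · intro hy i j hij
    have hx : (Pi.single s(i, j) 1 : Sym2 V → ℂ) ∈ modelSpace G := by
      intro a b hab hadj
      simp only [symMatrix, Matrix.of_apply]
      refine Pi.single_eq_of_ne (fun h => ?_) _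
      rcases Sym2.eq_iff.mp h with ⟨rfl, rfl⟩ | ⟨rfl, rfl⟩
      · exact hij.elim hab hadj
      · exact hij.elim (fun e => hab e.symm) (fun e => hadj e.symm)
    have h := hy _ hx
    have key : ∀ a b : V, symMatrix (Pi.single s(i, j) 1 : Sym2 V → ℂ) a b * symMatrix y b a
        = (if (a = i ∧ b = j) ∨ (a = j ∧ b = i) then 1 else 0) * y s(i, j) := by
      intro a b
      simp only [symMatrix, Matrix.of_apply, Pi.single_apply]
      by_cases h1 : s(a, b) = s(i, j)
      · rw [if_pos h1, if_pos (Sym2.eq_iff.mp h1), Sym2.eq_swap, h1]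
      · rw [if_neg h1, if_neg (fun h2 => h1 (Sym2.eq_iff.mpr h2))]
        simp
    simp only [Matrix.trace, Matrix.diag, Matrix.mul_apply, key, ← Finset.sum_mul] at h
    rcases mul_eq_zero.mp h with h0 | h0
    · exfalso
      rw [← Finset.sum_product', Finset.sum_boole, Nat.cast_eq_zero, Finset.card_eq_zero] at h0
      have hmem : (i, j) ∈ (∅ : Finset (V × V)) := by
        rw [← h0]
        simp
      simp at hmem
    · exact h0
  · intro hy x hx
    simp only [Matrix.trace, Matrix.diag, Matrix.mul_apply]
    refine Finset.sum_eq_zero fun a _ => Finset.sum_eq_zero fun b _ => ?_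
    by_cases hab : b = a ∨ G.Adj b a
    · rw [hy b a hab, mul_zero]
    · push Not at hab
      rw [hx a b (fun e => hab.1 e.symm) (fun e => hab.2 e.symm), zero_mul]

/-- The set `{K⁻¹ : K ∈ L_G invertible}`. -/
def inverseSet {V : Type*} [Fintype V] [DecidableEq V] (G : SimpleGraph V) : Set (Sym2 V → ℂ) :=
  {x | ∃ k ∈ modelSpace G, IsUnit (symMatrix k).det ∧ symMatrix x = (symMatrix k)⁻¹}

/-- The ideal of all polynomials in the coordinates `x_{i,j}` that vanish on `L_G^{-1}`
(equivalently, on the dense subset of inverses). -/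
def inverseIdeal {V : Type*} [Fintype V] [DecidableEq V] (G : SimpleGraph V) :
    Ideal (MvPolynomial (Sym2 V) ℂ) :=
  vanishingIdeal ℂ (inverseSet G)

/-- The variety `L_G^{-1}`: the Zariski closure of `{K⁻¹ : K ∈ L_G invertible}`. -/
def inverseVariety {V : Type*} [Fintype V] [DecidableEq V] (G : SimpleGraph V) :
    Set (Sym2 V → ℂ) :=
  zeroLocus ℂ (inverseIdeal G)

/-- The affine space `Id + L_G^⊥`. -/
def identitySlice {V : Type*} [Fintype V] [DecidableEq V] (G : SimpleGraph V) :
    Set (Sym2 V → ℂ) :=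
  {x | ∃ y ∈ modelPerp G, symMatrix x = 1 + symMatrix y}

/-- The ideal of the affine space `Id + L_G^⊥`. -/
def sliceIdeal {V : Type*} [Fintype V] [DecidableEq V] (G : SimpleGraph V) :
    Ideal (MvPolynomial (Sym2 V) ℂ) :=
  vanishingIdeal ℂ (identitySlice G)

/-- The ideal of the scheme-theoretic intersection of `L_G^{-1}` and `Id + L_G^⊥`: the sum of the
two ideals (no radical is taken). -/
def intersectionIdeal {V : Type*} [Fintype V] [DecidableEq V] (G : SimpleGraph V) :
    Ideal (MvPolynomial (Sym2 V) ℂ) :=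
  inverseIdeal G ⊔ sliceIdeal G

/-- The row of the Jacobian matrix that belongs to `f`: the partial derivatives of `f` at `x`. -/
def gradientAt {σ : Type*} (x : σ → ℂ) (f : MvPolynomial σ ℂ) : σ → ℂ :=
  fun e => eval x (pderiv e f)

/-- The space spanned by the rows of the Jacobian matrix at `x` of the polynomials in `I`. -/
def jacobianRowSpace {σ : Type*} (I : Ideal (MvPolynomial σ ℂ)) (x : σ → ℂ) :
    Submodule ℂ (σ → ℂ) :=
  Submodule.span ℂ (gradientAt x '' (I : Set (MvPolynomial σ ℂ)))

/-- The Zariski tangent space at `x` of the affine scheme with ideal `I`: the kernel of the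
Jacobian matrix. -/
def zariskiTangentSpace {σ : Type*} [Fintype σ] (I : Ideal (MvPolynomial σ ℂ)) (x : σ → ℂ) :
    Submodule ℂ (σ → ℂ) where
  carrier := {v | ∀ f ∈ I, ∑ e, gradientAt x f e * v e = 0}
  zero_mem' := fun f _ => by simp
  add_mem' := fun {v w} hv hw f hf => by
    simp only [Pi.add_apply, mul_add, Finset.sum_add_distrib, hv f hf, hw f hf, add_zero]
  smul_mem' := fun c v hv f hf => by
    have h : ∑ e, gradientAt x f e * (c • v) e = c * ∑ e, gradientAt x f e * v e := by
      rw [Finset.mul_sum]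
      exact Finset.sum_congr rfl fun e _ => by simp [mul_left_comm]
    rw [h, hv f hf, mul_zero]

/-- The local ring at the point `x` of the affine scheme with ideal `I`. -/
abbrev schemeLocalRing {σ : Type*} (I : Ideal (MvPolynomial σ ℂ)) (x : σ → ℂ) : Type _ :=
  Localization.AtPrime (vanishingIdeal ℂ {x} : Ideal (MvPolynomial σ ℂ)) ⧸
    I.map (algebraMap (MvPolynomial σ ℂ)
      (Localization.AtPrime (vanishingIdeal ℂ {x} : Ideal (MvPolynomial σ ℂ))))

/-- `x` is an isolated point of `Z` in the Zariski topology: some polynomial does not vanish at `x`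
but vanishes at all other points of `Z`. -/
def IsZariskiIsolated {σ : Type*} (Z : Set (σ → ℂ)) (x : σ → ℂ) : Prop :=
  x ∈ Z ∧ ∃ g : MvPolynomial σ ℂ, eval x g ≠ 0 ∧ ∀ y ∈ Z, y ≠ x → eval y g = 0

end

noncomputable section


/-! ### Symmetric periodic arrays with vanishing minors -/

/-! Transversality reduces to one claim: a vector `v` tangent to both varieties at `A` is zero. For
such `v`, the matrix `A + εv` over the dual numbers has unit diagonal, zeros at the edges, and
satisfies every equation of `L⁻¹`. Among these are the 3 × 3 minors of `minor_mem_inverseIdeal`, one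
family per vertex; they come from `K X = 1`, since a row of `K` has only three possibly nonzero
entries.

These minors force a dichotomy on the entries `a i = B i (i + 2)`. If some `1 - (a i)²` is a unit,
the array is the identity (`eq_zero_of_isUnit`). Otherwise every `(a i)²` is 1, and up to signs a
column obeys the Chebyshev recurrence with a constant parameter `u`. Periodicity gives `U_{n-3}(u) =
0`; roots of `U` are simple, so `u`, and with it the whole array, has no `ε`-part (`snd_column`).

A zero common tangent space means full Jacobian rank, and Nakayama's lemma then gives reducedness
and isolation. For the dimension, semicontinuity gives `dim T_A ≥ 2n`, while trivial intersection
with `L^⊥`, of codimension `2n`, gives the reverse inequality. -/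

/-- The roots of the Chebyshev polynomials of the second kind are simple. -/
theorem eval_derivative_chebyshev_U_ne_zero (m : ℕ) (z : ℂ)
    (hz : (Polynomial.Chebyshev.U ℂ m).eval z = 0) :
    (Polynomial.Chebyshev.U ℂ m).derivative.eval z ≠ 0 := by
  intro hd
  -- At a double root, `h1` makes `T_{m+1}` vanish, then `h2` makes `U_{m+1}` vanish, contradicting
  -- the quadratic relation `h3` between consecutive terms.
  have h1 := congrArg (Polynomial.eval z)
    (Polynomial.Chebyshev.add_one_mul_T_eq_poly_in_U (R := ℂ) m)
  have h2 := congrArg (Polynomial.eval z) (Polynomial.Chebyshev.U_eq_X_mul_U_add_T ℂ m)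
  have h3 := congrArg (fun p => (p.comp (2 * Polynomial.X)).eval z)
    (Polynomial.Chebyshev.S_sq_add_S_sq ℂ m)
  simp only [Polynomial.add_comp, Polynomial.sub_comp, Polynomial.pow_comp, Polynomial.mul_comp,
    Polynomial.Chebyshev.S_comp_two_mul_X] at h3
  simp [hz, hd] at h1 h2 h3
  have h4 : (m : ℂ) + 1 ≠ 0 := Nat.cast_add_one_ne_zero m
  rw [h2, h1.resolve_left h4] at h3
  simp at h3

/-- A symmetric array, `n`-periodic in each index, with unit diagonal and vanishing entries next to
it, all of whose `3 × 3` minors on three consecutive rows vanish, as long as the columns avoid the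
middle row. -/
structure IsCycleArray {R : Type*} [CommRing R] (n : ℕ) (B : ℕ → ℕ → R) : Prop where
  symm : ∀ i j, B i j = B j i
  add_period : ∀ i j, B (i + n) j = B i j
  diag : ∀ i, B i i = 1
  adj : ∀ i, B i (i + 1) = 0
  minor : ∀ i (c : Fin 3 → ℕ), (∀ p, ¬ c p ≡ i + 1 [MOD n]) →
    (Matrix.of fun p q : Fin 3 => B (i + p) (c q)).det = 0

/-! ### Consequences of the minors over a commutative ring -/

namespace IsCycleArray

variable {R : Type*} [CommRing R] {n : ℕ} {B : ℕ → ℕ → R}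

theorem shift (h : IsCycleArray n B) (s : ℕ) : IsCycleArray n fun i j => B (i + s) (j + s) where
  symm i j := h.symm _ _
  add_period i j := by rw [add_right_comm, h.add_period]
  diag i := h.diag _
  adj i := by rw [add_right_comm, h.adj]
  minor i c hc := by
    have := h.minor (i + s) (fun p => c p + s) (fun p hp => hc p ?_)
    · simpa only [add_right_comm] using this
    · exact Nat.ModEq.add_right_cancel' s (by simpa only [add_right_comm] using hp)

theorem adj' (h : IsCycleArray n B) (i : ℕ) : B (i + 1) i = 0 := by rw [h.symm, h.adj]

theorem not_modEq (hn : 3 ≤ n) (i : ℕ) {d : ℕ} (hd : d ≤ 3) (hd1 : d ≠ 1) :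
    ¬ i + d ≡ i + 1 [MOD n] := by
  intro h
  have h' := Nat.ModEq.add_left_cancel' i h
  rcases (by omega : d = 0 ∨ d = 2 ∨ d = 3) with rfl | rfl | rfl
  · have := (Nat.modEq_iff_dvd' (by omega)).mp h'
    have := Nat.le_of_dvd (by omega) this
    omega
  · have := (Nat.modEq_iff_dvd' (by omega)).mp h'.symm
    have := Nat.le_of_dvd (by omega) this
    omega
  · have := (Nat.modEq_iff_dvd' (by omega)).mp h'.symm
    have := Nat.le_of_dvd (by omega) this
    omega

/-- In columns `i, i + 2, j` the middle row is `(0, 0, B (i + 1) j)`, so the minor factors. -/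
theorem mul_one_sub_sq (h : IsCycleArray n B) (hn : 3 ≤ n) (i j : ℕ)
    (hj : ¬ j ≡ i + 1 [MOD n]) : B (i + 1) j * (1 - B i (i + 2) ^ 2) = 0 := by
  have := h.minor i ![i, i + 2, j] (by
    intro p
    fin_cases p
    · exact not_modEq hn i (d := 0) (by omega) (by omega)
    · exact not_modEq hn i (d := 2) (by omega) (by omega)
    · exact hj)
  simp [Matrix.det_fin_three, h.diag, h.adj, h.adj', h.symm (i + 2) i] at this
  linear_combination -this

/-- If one entry at distance two does not square to one, then the array is the identity. -/
theorem eq_zero_of_isUnit (h : IsCycleArray n B) (hn : 3 ≤ n) (i : ℕ)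
    (hi : IsUnit (1 - B i (i + 2) ^ 2)) (k j : ℕ) (hj : ¬ j ≡ k [MOD n]) : B k j = 0 := by
  have key : ∀ m j, ¬ j ≡ i + m + 1 [MOD n] →
      IsUnit (1 - B (i + m) (i + m + 2) ^ 2) ∧ B (i + m + 1) j = 0 := by
    intro m
    induction m with
    | zero => exact fun j hj => ⟨hi, hi.mul_left_eq_zero.mp (h.mul_one_sub_sq hn i j hj)⟩
    | succ m ih =>
      intro j hj
      -- The row just killed contains the next entry at distance two, so the next factor is 1 and
      -- the argument propagates.
      have hu : IsUnit (1 - B (i + (m + 1)) (i + (m + 1) + 2) ^ 2) := by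
        rw [← add_assoc, (ih (i + m + 1 + 2) (not_modEq hn (i + m) (d := 3) le_rfl (by omega))).2]
        simp
      exact ⟨hu, hu.mul_left_eq_zero.mp (h.mul_one_sub_sq hn _ j hj)⟩
  have hper : ∀ m, B (k + m * n) j = B k j := by
    intro m
    induction m with
    | zero => simp
    | succ m ih => rw [add_mul, one_mul, ← add_assoc, h.add_period, ih]
  -- Propagation only goes upward, so enough periods are added to `k` to pass `i + 1`.
  have hle : i + 1 ≤ k + (i + 1) * n := by nlinarith
  obtain ⟨m, hm⟩ := Nat.exists_eq_add_of_le hle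
  have hm' : k + (i + 1) * n = i + m + 1 := by omega
  rw [← hper (i + 1), hm']
  refine (key m j fun hc => hj (hc.trans ?_)).2
  rw [← hm']
  simp [Nat.ModEq]

/-- Columns `i + 2, i + 3, j` give a linear relation between three consecutive rows; multiplying by
the signs `B i (i + 2)` and `B (i + 1) (i + 3)` solves it for the last one. -/
theorem recurrence (h : IsCycleArray n B) (hn : 3 ≤ n) (ha : ∀ i, B i (i + 2) ^ 2 = 1) (i j : ℕ)
    (hj : ¬ j ≡ i + 1 [MOD n]) :
    B (i + 2) j = B i (i + 2) * B i j
      - B i (i + 2) * B (i + 1) (i + 3) * B i (i + 3) * B (i + 1) j := by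
  have := h.minor i ![i + 2, i + 3, j] (by
    intro p
    fin_cases p
    · exact not_modEq hn i (d := 2) (by omega) (by omega)
    · exact not_modEq hn i (d := 3) (by omega) (by omega)
    · exact hj)
  simp [Matrix.det_fin_three, h.diag, h.adj] at this
  have h1 := ha i
  have h2 := ha (i + 1)
  simp only [add_assoc, Nat.reduceAdd] at h2
  linear_combination B i (i + 2) * B (i + 1) (i + 3) * this -
    B (i + 1) (i + 3) ^ 2 * B (i + 2) j * h1 - (B (i + 2) j - B i j * B i (i + 2)) * h2

theorem recurrence_distance_three (h : IsCycleArray n B) (hn : 3 ≤ n)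
    (ha : ∀ i, B i (i + 2) ^ 2 = 1) (i : ℕ) :
    B i (i + 3) = - B i (i + 2) * B (i + 1) (i + 3) * B (i + 2) (i + 4) * B (i + 1) (i + 4) := by
  have := h.recurrence hn ha (i + 1) i (fun hc => by
    have := (Nat.modEq_iff_dvd' (by omega)).mp hc
    have := Nat.le_of_dvd (by omega) this
    omega)
  simp only [add_assoc, Nat.reduceAdd, h.adj', h.symm _ i] at this
  rw [this]
  ring

/-- The signs that turn the columns of the array into Chebyshev sequences. -/
def columnSign (B : ℕ → ℕ → R) : ℕ → R
  | 0 => 1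
  | 1 => 1
  | k + 2 => - B k (k + 2) * columnSign B k

theorem columnSign_sq (ha : ∀ i, B i (i + 2) ^ 2 = 1) (k : ℕ) : columnSign B k ^ 2 = 1 := by
  induction k using Nat.twoStepInduction with
  | zero => simp [columnSign]
  | one => simp [columnSign]
  | more k ih _ => rw [columnSign, mul_pow, neg_sq, ha, ih, one_mul]

/-- The middle coefficient of the recurrence, after rescaling by the signs, does not depend on `k`;
it is the `2u` of the Chebyshev recurrence. -/
theorem parameter_eq (h : IsCycleArray n B) (hn : 3 ≤ n) (ha : ∀ i, B i (i + 2) ^ 2 = 1) (k : ℕ) :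
    B (k + 1) (k + 3) * B k (k + 3) * columnSign B (k + 1) * columnSign B k
      = B 1 3 * B 0 3 := by
  induction k with
  | zero => simp [columnSign]
  | succ k ih =>
    rw [← ih, columnSign, h.recurrence_distance_three hn ha k]
    have h2 := ha (k + 1)
    simp only [add_assoc, Nat.reduceAdd] at h2 ⊢
    linear_combination (- B (k + 2) (k + 4) * B (k + 1) (k + 4) * B k (k + 2) *
      columnSign B k * columnSign B (k + 1)) * (- h2)

/-- The index shift fits the initial values: `U_{-2} = -1` matches the diagonal entry and `U_{-1} =
0` its neighbour. -/
theorem column_eq (h : IsCycleArray n B) (hn : 3 ≤ n) (ha : ∀ i, B i (i + 2) ^ 2 = 1)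
    (u : R) (hu : 2 * u = B 1 3 * B 0 3) (k : ℕ) (hk : k ≤ n) :
    B k 0 = - columnSign B k * (Polynomial.Chebyshev.U R ((k : ℤ) - 2)).eval u := by
  induction k using Nat.twoStepInduction with
  | zero => simp [columnSign, h.diag]
  | one =>
    have : ((1 : ℕ) : ℤ) - 2 = -1 := by norm_num
    rw [this]
    simp [h.adj' 0]
  | more k ih0 ih1 =>
    rw [h.recurrence hn ha k 0 (fun hc => by
      have := (Nat.modEq_iff_dvd' (by omega)).mp hc
      have := Nat.le_of_dvd (by omega) this
      omega), ih0 (by omega), ih1 (by omega)]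
    have e1 : ((k + 2 : ℕ) : ℤ) - 2 = ((k : ℤ) - 2) + 2 := by push_cast; ring
    have e2 : ((k + 1 : ℕ) : ℤ) - 2 = ((k : ℤ) - 2) + 1 := by push_cast; ring
    rw [e1, e2, Polynomial.Chebyshev.U_add_two, columnSign]
    simp only [Polynomial.eval_sub, Polynomial.eval_mul, Polynomial.eval_ofNat, Polynomial.eval_X]
    rw [hu, ← h.parameter_eq hn ha k]
    linear_combination (- B k (k + 2) * B (k + 1) (k + 3) * B k (k + 3) * columnSign B (k + 1) *
      Polynomial.eval u (Polynomial.Chebyshev.U R ((k : ℤ) - 2 + 1))) * (columnSign_sq ha k)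

/-- Row `n - 1` is cyclically next to column 0, so its entry there vanishes. -/
theorem chebyshev_eq_zero (h : IsCycleArray n B) (hn : 3 ≤ n) (ha : ∀ i, B i (i + 2) ^ 2 = 1)
    (u : R) (hu : 2 * u = B 1 3 * B 0 3) :
    (Polynomial.Chebyshev.U R ((n - 3 : ℕ) : ℤ)).eval u = 0 := by
  have h0 := h.column_eq hn ha u hu (n - 1) (by omega)
  have e : B (n - 1) 0 = 0 := by
    have := h.adj (n - 1)
    rwa [Nat.sub_add_cancel (by omega), h.symm, ← zero_add n, h.add_period, h.symm, zero_add] at this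
  have e2 : ((n - 1 : ℕ) : ℤ) - 2 = ((n - 3 : ℕ) : ℤ) := by omega
  rw [e, e2] at h0
  linear_combination (columnSign B (n - 1)) * h0
    - Polynomial.eval u (Polynomial.Chebyshev.U R ((n - 3 : ℕ) : ℤ)) * columnSign_sq ha (n - 1)

end IsCycleArray

/-! ### Cycle arrays over the dual numbers are constant to first order -/

namespace IsCycleArray

open TrivSqZeroExt

variable {n : ℕ} {B : ℕ → ℕ → DualNumber ℂ}

theorem snd_eq_zero_of_sq_eq_one {a : DualNumber ℂ} (h : a ^ 2 = 1) : snd a = 0 := by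
  have h1 := congrArg fst h
  have h2 := congrArg snd h
  simp [pow_two] at h1 h2
  have : fst a * snd a = 0 := by linear_combination h2 / 2
  rcases mul_eq_zero.mp this with h3 | h3
  · simp [h3] at h1
  · exact h3

theorem aeval_dualNumber (p : Polynomial ℂ) (u : DualNumber ℂ) :
    Polynomial.aeval u p = inl (p.eval (fst u)) + inr (p.derivative.eval (fst u) * snd u) := by
  have e := inl_fst_add_inr_snd_eq u
  have h := Polynomial.aeval_add_of_sq_eq_zero p (inl (fst u) : DualNumber ℂ) (inr (snd u))
    (by simp [pow_two])
  have hc : ∀ q : Polynomial ℂ, Polynomial.aeval (inl (fst u) : DualNumber ℂ) q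
      = inl (q.eval (fst u)) := fun q =>
    Polynomial.aeval_algebraMap_apply (DualNumber ℂ) (fst u) q
  rw [e, hc, hc, inl_mul_inr] at h
  simpa using h

theorem snd_column (h : IsCycleArray n B) (hn : 3 ≤ n) (k : ℕ) (hk : k < n) : snd (B k 0) = 0 := by
  by_cases hc : ∃ i, IsUnit (1 - B i (i + 2) ^ 2)
  · obtain ⟨i, hi⟩ := hc
    rcases Nat.eq_zero_or_pos k with rfl | hk0
    · simp [h.diag]
    · rw [h.eq_zero_of_isUnit hn i hi k 0 fun hc => ?_, snd_zero]
      have := Nat.le_of_dvd (by omega) ((Nat.modEq_iff_dvd' (by omega)).mp hc)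
      omega
  · push Not at hc
    have hfst : ∀ i, fst (B i (i + 2)) ^ 2 = 1 := by
      intro i
      have := hc i
      rw [isUnit_iff_isUnit_fst, isUnit_iff_ne_zero, not_not] at this
      simp at this
      linear_combination - this
    -- So far the squares are 1 only modulo `ε`. Hence `B (i + 1) (i + 3)` is a unit, and cancelling
    -- it in `mul_one_sub_sq` at column `i + 3` makes the equality exact.
    have ha : ∀ i, B i (i + 2) ^ 2 = 1 := by
      intro i
      have h1 := h.mul_one_sub_sq hn i (i + 3) (not_modEq hn i le_rfl (by omega))
      have hu : IsUnit (B (i + 1) (i + 1 + 2)) := by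
        rw [isUnit_iff_isUnit_fst, isUnit_iff_ne_zero]
        intro h0
        have := hfst (i + 1)
        simp [h0] at this
      have := hu.mul_right_eq_zero.mp h1
      linear_combination - this
    set t := B 1 3 * B 0 3 with ht
    let u : DualNumber ℂ := (2⁻¹ : ℂ) • t
    have hu : 2 * u = t := by
      ext <;> simp [u, two_mul] <;> ring
    have hz := h.chebyshev_eq_zero hn ha u hu
    have hev : ∀ m : ℤ, (Polynomial.Chebyshev.U (DualNumber ℂ) m).eval u
        = Polynomial.aeval u (Polynomial.Chebyshev.U ℂ m) := by
      intro m
      rw [← Polynomial.Chebyshev.map_U (algebraMap ℂ (DualNumber ℂ)), Polynomial.eval_map_algebraMap]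
    rw [hev, aeval_dualNumber] at hz
    have hz1 := congrArg fst hz
    have hz2 := congrArg snd hz
    simp at hz1 hz2
    -- The `ε`-part of `U(u) = 0` is `U'(u₀) u₁ = 0`, and `u₀` is a simple root.
    have hsu : snd u = 0 :=
      hz2.resolve_left (eval_derivative_chebyshev_U_ne_zero (n - 3) _ hz1)
    rw [h.column_eq hn ha u hu k hk.le, hev, aeval_dualNumber, hsu]
    simp [snd_eq_zero_of_sq_eq_one (columnSign_sq ha k)]

end IsCycleArray


/-! ### Gradients, Zariski tangent spaces and the Jacobian criterion -/

section Jacobian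

variable {σ : Type*}

/-- The gradient at `x` as a linear map. -/
def gradientLinearMap (x : σ → ℂ) : MvPolynomial σ ℂ →ₗ[ℂ] (σ → ℂ) where
  toFun := gradientAt x
  map_add' f g := by ext e; simp [gradientAt]
  map_smul' c f := by ext e; simp [gradientAt]

theorem gradientAt_mul (x : σ → ℂ) (f g : MvPolynomial σ ℂ) (e : σ) :
    gradientAt x (f * g) e = eval x f * gradientAt x g e + eval x g * gradientAt x f e := by
  simp [gradientAt, Derivation.leibniz]

theorem gradientAt_X_sub_C [DecidableEq σ] (x : σ → ℂ) (e : σ) (c : ℂ) :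
    gradientAt x (X e - C c) = Pi.single e 1 := by
  ext d
  simp only [gradientAt, map_sub, pderiv_X, pderiv_C, sub_zero]
  by_cases h : e = d
  · subst h
    simp
  · rw [Pi.single_eq_of_ne h, Pi.single_eq_of_ne (Ne.symm h)]
    simp

/-- The gradient is linear and an ideal is a subspace, so its image needs no span. -/
theorem mem_jacobianRowSpace_iff {I : Ideal (MvPolynomial σ ℂ)} {x w : σ → ℂ} :
    w ∈ jacobianRowSpace I x ↔ ∃ f ∈ I, gradientAt x f = w := by
  have : jacobianRowSpace I x = (I.restrictScalars ℂ).map (gradientLinearMap x) := by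
    rw [jacobianRowSpace, ← Submodule.span_eq (Submodule.map _ _)]
    rfl
  rw [this]
  rfl

variable [Fintype σ]

theorem finrank_jacobianRowSpace_add_finrank_zariskiTangentSpace
    (I : Ideal (MvPolynomial σ ℂ)) (x : σ → ℂ) :
    Module.finrank ℂ (jacobianRowSpace I x) + Module.finrank ℂ (zariskiTangentSpace I x)
      = Fintype.card σ := by
  classical
  have h := Subspace.finrank_add_finrank_dualCoannihilator_eq
    ((jacobianRowSpace I x).map (dotProductEquiv ℂ σ).toLinearMap)
  have e : ((jacobianRowSpace I x).map (dotProductEquiv ℂ σ).toLinearMap).dualCoannihilator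
      = zariskiTangentSpace I x := by
    ext v
    rw [Submodule.mem_dualCoannihilator]
    constructor
    · intro hv f hf
      exact hv _ (Submodule.mem_map_of_mem (mem_jacobianRowSpace_iff.mpr ⟨f, hf, rfl⟩))
    · rintro hv _ ⟨w, hw, rfl⟩
      obtain ⟨f, hf, rfl⟩ := mem_jacobianRowSpace_iff.mp hw
      exact hv f hf
  rw [e, LinearEquiv.finrank_map_eq, Module.finrank_fintype_fun_eq_card] at h
  exact h

theorem zariskiTangentSpace_sup (I J : Ideal (MvPolynomial σ ℂ)) (x : σ → ℂ) :
    zariskiTangentSpace (I ⊔ J) x = zariskiTangentSpace I x ⊓ zariskiTangentSpace J x := by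
  ext v
  constructor
  · exact fun hv => ⟨fun f hf => hv f (Ideal.mem_sup_left hf),
      fun f hf => hv f (Ideal.mem_sup_right hf)⟩
  · rintro ⟨h1, h2⟩ f hf
    obtain ⟨g, hg, k, hk, rfl⟩ := Submodule.mem_sup.mp hf
    have e := (gradientLinearMap x).map_add g k
    change gradientAt x (g + k) = gradientAt x g + gradientAt x k at e
    simp only [e, Pi.add_apply, add_mul, Finset.sum_add_distrib, h1 g hg, h2 k hk, add_zero]

theorem jacobianRowSpace_eq_top {I : Ideal (MvPolynomial σ ℂ)} {x : σ → ℂ}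
    (h : zariskiTangentSpace I x = ⊥) : jacobianRowSpace I x = ⊤ := by
  apply Submodule.eq_top_of_finrank_eq
  have := finrank_jacobianRowSpace_add_finrank_zariskiTangentSpace I x
  rw [h, finrank_bot, add_zero] at this
  rw [this, Module.finrank_fintype_fun_eq_card]

theorem hasDerivAt_eval {γ : ℂ → σ → ℂ} {v : σ → ℂ} {s : ℂ}
    (hγ : ∀ e, HasDerivAt (fun t => γ t e) (v e) s) (f : MvPolynomial σ ℂ) :
    HasDerivAt (fun t => eval (γ t) f) (∑ e, gradientAt (γ s) f e * v e) s := by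
  classical
  induction f using MvPolynomial.induction_on with
  | C a => simpa [gradientAt] using hasDerivAt_const s a
  | add f g hf hg =>
    have e := (gradientLinearMap (γ s)).map_add f g
    change gradientAt (γ s) (f + g) = gradientAt (γ s) f + gradientAt (γ s) g at e
    simpa only [e, Pi.add_apply, add_mul, Finset.sum_add_distrib, map_add] using! hf.add hg
  | mul_X f i hf =>
    have h := hf.mul (hγ i)
    simp only [gradientAt_mul, map_mul, eval_X]
    refine h.congr_deriv ?_
    have e : gradientAt (γ s) (X i) = Pi.single i 1 := by
      simpa using gradientAt_X_sub_C (γ s) i 0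
    simp [e, add_mul, Finset.sum_add_distrib, Pi.single_apply, Finset.sum_mul]
    rw [add_comm]
    congr 1
    exact Finset.sum_congr rfl fun _ _ => by ring

/-- The velocity of a curve in `S` is tangent to the Zariski closure of `S`. -/
theorem mem_zariskiTangentSpace_of_hasDerivAt {S : Set (σ → ℂ)} {γ : ℂ → σ → ℂ} {v : σ → ℂ} {s : ℂ}
    (hγ : ∀ e, HasDerivAt (fun t => γ t e) (v e) s) (hS : ∀ᶠ t in nhds s, γ t ∈ S) :
    v ∈ zariskiTangentSpace (vanishingIdeal ℂ S) (γ s) := by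
  intro f hf
  refine (hasDerivAt_eval hγ f).unique ((hasDerivAt_const s 0).congr_of_eventuallyEq ?_)
  filter_upwards [hS] with t ht
  simpa [aeval_eq_eval] using hf _ ht

/-- The first order Taylor expansion of a polynomial. -/
theorem taylor_mem_sq (x : σ → ℂ) (f : MvPolynomial σ ℂ) :
    f - C (eval x f) - ∑ e, C (gradientAt x f e) * (X e - C (x e)) ∈
      (vanishingIdeal ℂ {x} : Ideal (MvPolynomial σ ℂ)) ^ 2 := by
  classical
  have hX : ∀ e, X e - C (x e) ∈ (vanishingIdeal ℂ {x} : Ideal (MvPolynomial σ ℂ)) := by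
    intro e
    rw [mem_vanishingIdeal_singleton_iff]
    simp
  induction f using MvPolynomial.induction_on with
  | C a => simp [gradientAt]
  | add f g hf hg =>
    have e := (gradientLinearMap x).map_add f g
    change gradientAt x (f + g) = gradientAt x f + gradientAt x g at e
    convert add_mem hf hg using 1
    simp only [e, Pi.add_apply, map_add, add_mul, Finset.sum_add_distrib]
    ring
  | mul_X f i hf =>
    have e : gradientAt x (X i) = Pi.single i 1 := by
      simpa using gradientAt_X_sub_C x i 0
    have h2 : (f - C (eval x f)) * (X i - C (x i)) ∈
        (vanishingIdeal ℂ {x} : Ideal (MvPolynomial σ ℂ)) ^ 2 := by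
      rw [pow_two]
      refine Ideal.mul_mem_mul ?_ (hX i)
      rw [mem_vanishingIdeal_singleton_iff]
      simp [aeval_eq_eval]
    convert add_mem h2 (Ideal.mul_mem_left _ (C (x i)) hf) using 1
    have h3 : ∑ d, C (gradientAt x (f * X i) d) * (X d - C (x d))
        = C (eval x f) * (X i - C (x i)) +
          C (x i) * ∑ d, C (gradientAt x f d) * (X d - C (x d)) := by
      simp only [gradientAt_mul, e, eval_X, map_add, map_mul, add_mul, Finset.sum_add_distrib,
        Finset.mul_sum, mul_assoc]
      congr 1
      rw [Finset.sum_eq_single i]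
      · simp
      · intro b _ hb
        simp [Pi.single_eq_of_ne hb]
      · simp
    rw [h3]
    simp only [map_mul, eval_X]
    ring

open scoped Pointwise in
/-- If the Jacobian matrix has full rank at a point of the scheme of `I`, then `I` and the maximal
ideal of the point agree near the point. -/
theorem exists_smul_vanishingIdeal_le {I : Ideal (MvPolynomial σ ℂ)} {x : σ → ℂ}
    (hx : I ≤ vanishingIdeal ℂ {x}) (h : jacobianRowSpace I x = ⊤) :
    ∃ g : MvPolynomial σ ℂ, eval x g = 1 ∧ ∀ f ∈ vanishingIdeal ℂ {x}, g * f ∈ I := by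
  classical
  set m : Ideal (MvPolynomial σ ℂ) := vanishingIdeal ℂ {x} with hm
  -- Full rank supplies `k ∈ I` with the gradient of `f`; then `f - k` vanishes to second order.
  have hle : m ≤ I ⊔ m • m := by
    intro f hf
    obtain ⟨k, hk, hkf⟩ := mem_jacobianRowSpace_iff.mp
      (h ▸ Submodule.mem_top : gradientAt x f ∈ jacobianRowSpace I x)
    have h0 : eval x (f - k) = 0 := by
      simpa [aeval_eq_eval] using
        (mem_vanishingIdeal_singleton_iff x _).mp (sub_mem hf (hx hk))
    have h1 : gradientAt x (f - k) = 0 := by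
      have := (gradientLinearMap x).map_sub f k
      change gradientAt x (f - k) = gradientAt x f - gradientAt x k at this
      rw [this, hkf, sub_self]
    have h2 := taylor_mem_sq x (f - k)
    rw [h0, h1, pow_two] at h2
    simp only [map_zero, sub_zero, Pi.zero_apply, zero_mul, Finset.sum_const_zero] at h2
    exact Submodule.mem_sup.mpr ⟨k, hk, f - k, h2, by ring⟩
  -- Nakayama's lemma, in the form that yields `g ≡ 1` modulo `m` with `g m ⊆ I`.
  obtain ⟨g, hg, hgm⟩ := Submodule.exists_sub_one_mem_and_smul_le_of_fg_of_le_sup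
    (IsNoetherian.noetherian m) le_rfl hle
  refine ⟨g, ?_, fun f hf => hgm (Submodule.smul_mem_pointwise_smul f g m hf)⟩
  have := (mem_vanishingIdeal_singleton_iff x _).mp hg
  simpa [aeval_eq_eval, sub_eq_zero] using this

/-- The polynomial `g` becomes a unit in the local ring, so `I` generates the maximal ideal and the
quotient is a field. -/
theorem isReduced_schemeLocalRing {I : Ideal (MvPolynomial σ ℂ)} {x : σ → ℂ}
    (hx : I ≤ vanishingIdeal ℂ {x}) (h : jacobianRowSpace I x = ⊤) :
    IsReduced (schemeLocalRing I x) := by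
  obtain ⟨g, hg1, hg⟩ := exists_smul_vanishingIdeal_le hx h
  set m : Ideal (MvPolynomial σ ℂ) := vanishingIdeal ℂ {x} with hm
  have hgu : IsUnit (algebraMap _ (Localization.AtPrime m) g) := by
    refine IsLocalization.map_units (M := m.primeCompl) _ ⟨g, fun hgm => ?_⟩
    have := (mem_vanishingIdeal_singleton_iff x _).mp hgm
    simp [aeval_eq_eval, hg1] at this
  have he : I.map (algebraMap _ (Localization.AtPrime m)) =
      IsLocalRing.maximalIdeal (Localization.AtPrime m) := by
    rw [← Localization.AtPrime.map_eq_maximalIdeal]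
    refine le_antisymm (Ideal.map_mono hx) (Ideal.map_le_iff_le_comap.mpr fun f hf => ?_)
    rw [Ideal.mem_comap, ← Ideal.unit_mul_mem_iff_mem _ hgu, ← map_mul]
    exact Ideal.mem_map_of_mem _ (hg f hf)
  change IsReduced (_ ⧸ I.map (algebraMap _ (Localization.AtPrime m)))
  rw [he]
  infer_instance

theorem isZariskiIsolated_of_jacobianRowSpace {I : Ideal (MvPolynomial σ ℂ)} {Z : Set (σ → ℂ)}
    {x : σ → ℂ} (hxZ : x ∈ Z) (hZ : Z ⊆ zeroLocus ℂ I) (h : jacobianRowSpace I x = ⊤) :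
    IsZariskiIsolated Z x := by
  have hx : I ≤ vanishingIdeal ℂ {x} := fun f hf =>
    (mem_vanishingIdeal_singleton_iff x f).mpr (hZ hxZ f hf)
  obtain ⟨g, hg1, hg⟩ := exists_smul_vanishingIdeal_le hx h
  refine ⟨hxZ, g, by simp [hg1], fun y hy hyx => ?_⟩
  obtain ⟨e, he⟩ := Function.ne_iff.mp hyx
  have h0 := hZ hy _ (hg (X e - C (x e)) (by simp))
  simp only [map_mul, map_sub, aeval_X, aeval_C, aeval_eq_eval] at h0
  exact (mul_eq_zero.mp h0).resolve_right (sub_ne_zero.mpr he)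

/-- The dimension of the Zariski tangent space is upper semicontinuous: every point of the Zariski
closure of `S` has a tangent space at least as large as that of some point of `S`. -/
theorem exists_finrank_zariskiTangentSpace_le {S : Set (σ → ℂ)} {x : σ → ℂ}
    (hx : x ∈ zeroLocus ℂ (vanishingIdeal ℂ S : Ideal (MvPolynomial σ ℂ))) :
    ∃ y ∈ S, Module.finrank ℂ (zariskiTangentSpace (vanishingIdeal ℂ S) y) ≤
      Module.finrank ℂ (zariskiTangentSpace (vanishingIdeal ℂ S) x) := by
  classical
  set I : Ideal (MvPolynomial σ ℂ) := vanishingIdeal ℂ S with hI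
  obtain ⟨r, hr⟩ : ∃ r, Module.finrank ℂ (jacobianRowSpace I x) = r := ⟨_, rfl⟩
  let b := Module.finBasisOfFinrankEq ℂ (jacobianRowSpace I x) hr
  choose f hfI hf using fun i => mem_jacobianRowSpace_iff.mp (b i).2
  let G : (σ → ℂ) → Matrix (Fin r) σ ℂ := fun y => Matrix.of fun i => gradientAt y (f i)
  have hli : LinearIndependent ℂ (G x).row := by
    have : (G x).row = fun i => ((b i : jacobianRowSpace I x) : σ → ℂ) := by
      ext i e
      exact congrFun (hf i) e
    rw [this]
    have hb := b.linearIndependent.map' (jacobianRowSpace I x).subtype (Submodule.ker_subtype _)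
    exact hb
  -- A constant right inverse `P` replaces a choice of columns: `det (G y * P)` is polynomial in
  -- `y`, equals 1 at `x`, and certifies rank `r` wherever it is nonzero.
  obtain ⟨P, hP⟩ : ∃ P : Matrix σ (Fin r) ℂ, G x * P = 1 := by
    rw [← Matrix.mulVec_surjective_iff_exists_right_inverse]
    change Function.Surjective (G x).mulVecLin
    rw [← LinearMap.range_eq_top]
    apply Submodule.eq_top_of_finrank_eq
    rw [← Matrix.rank, hli.rank_matrix, Module.finrank_fintype_fun_eq_card]
  let GX : Matrix (Fin r) σ (MvPolynomial σ ℂ) := Matrix.of fun i e => pderiv e (f i)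
  let PX : Matrix σ (Fin r) (MvPolynomial σ ℂ) := Matrix.of fun e j => C (P e j)
  let D : MvPolynomial σ ℂ := (GX * PX).det
  have hD : ∀ y, eval y D = (G y * P).det := by
    intro y
    change eval y ((GX * PX).det) = _
    rw [RingHom.map_det, RingHom.mapMatrix_apply, Matrix.map_mul]
    congr 1
    ext i j
    simp [GX, PX, G, Matrix.mul_apply, gradientAt]
  have hDI : D ∉ I := by
    intro hmem
    have := hx D hmem
    rw [aeval_eq_eval] at this
    change eval x D = 0 at this
    simp [hD, hP] at this
  obtain ⟨y, hyS, hy⟩ : ∃ y ∈ S, eval y D ≠ 0 := by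
    by_contra! hcon
    exact hDI fun y hy => by simpa [aeval_eq_eval] using hcon y hy
  refine ⟨y, hyS, ?_⟩
  have h1 := finrank_jacobianRowSpace_add_finrank_zariskiTangentSpace I x
  have h2 := finrank_jacobianRowSpace_add_finrank_zariskiTangentSpace I y
  suffices r ≤ Module.finrank ℂ (jacobianRowSpace I y) by omega
  have hrk : r ≤ (G y).rank := by
    have h3 : (G y * P).rank = r := by
      rw [Matrix.rank_of_isUnit _ ((Matrix.isUnit_iff_isUnit_det _).mpr
        (isUnit_iff_ne_zero.mpr (hD y ▸ hy))), Fintype.card_fin]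
    exact h3.symm.le.trans (Matrix.rank_mul_le_left _ _)
  refine hrk.trans ?_
  rw [Matrix.rank_eq_finrank_span_row]
  refine Submodule.finrank_mono (Submodule.span_le.mpr ?_)
  rintro _ ⟨i, rfl⟩
  exact mem_jacobianRowSpace_iff.mpr ⟨f i, hfI i, rfl⟩

/-- Evaluation at a tangent direction over the dual numbers. -/
theorem aeval_inl_add_inr (x v : σ → ℂ) (f : MvPolynomial σ ℂ) :
    aeval (fun e => (TrivSqZeroExt.inl (x e) + TrivSqZeroExt.inr (v e) : DualNumber ℂ)) f
      = TrivSqZeroExt.inl (eval x f) + TrivSqZeroExt.inr (∑ e, gradientAt x f e * v e) := by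
  classical
  induction f using MvPolynomial.induction_on with
  | C a => simp [gradientAt, TrivSqZeroExt.algebraMap_eq_inl]
  | add f g hf hg =>
    have e := (gradientLinearMap x).map_add f g
    change gradientAt x (f + g) = gradientAt x f + gradientAt x g at e
    rw [map_add, hf, hg]
    simp only [e, Pi.add_apply, add_mul, Finset.sum_add_distrib, map_add]
    ext <;> simp
  | mul_X f i hf =>
    have e : gradientAt x (X i) = Pi.single i 1 := by
      simpa using gradientAt_X_sub_C x i 0
    rw [map_mul, hf, aeval_X]
    ext
    · simp
    · simp [gradientAt_mul, e, add_mul, Finset.sum_add_distrib, Pi.single_apply, mul_assoc,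
        ← Finset.mul_sum]
      exact mul_comm _ _

theorem aeval_eq_zero_of_mem_zariskiTangentSpace {I : Ideal (MvPolynomial σ ℂ)} {x v : σ → ℂ}
    (hx : x ∈ zeroLocus ℂ I) (hv : v ∈ zariskiTangentSpace I x) {f : MvPolynomial σ ℂ}
    (hf : f ∈ I) :
    aeval (fun e => (TrivSqZeroExt.inl (x e) + TrivSqZeroExt.inr (v e) : DualNumber ℂ)) f = 0 := by
  have h := hx f hf
  rw [aeval_eq_eval] at h
  change eval x f = 0 at h
  rw [aeval_inl_add_inr, h, hv f hf]
  simp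

end Jacobian


/-! ### The model space, its complement, and the tangent spaces of the two varieties -/

section Graph

variable {V : Type*}

theorem symMatrix_apply (x : Sym2 V → ℂ) (i j : V) : symMatrix x i j = x s(i, j) := rfl

/-- The coordinate vector of a symmetric matrix. -/
def symCoord : Matrix V V ℂ →ₗ[ℂ] (Sym2 V → ℂ) where
  toFun M e := M (Quot.out e).1 (Quot.out e).2
  map_add' _ _ := rfl
  map_smul' _ _ := rfl

theorem symMatrix_symCoord {M : Matrix V V ℂ} (hM : M.IsSymm) : symMatrix (symCoord M) = M := by
  obtain ⟨x, rfl, -⟩ := existsUnique_symMatrix M hM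
  ext i j
  change x s(_, _) = x s(i, j)
  congr 1
  exact Quot.out_eq s(i, j)

theorem mem_modelSpace_iff (G : SimpleGraph V) (x : Sym2 V → ℂ) :
    x ∈ modelSpace G ↔ ∀ e, ¬ (e.IsDiag ∨ e ∈ G.edgeSet) → x e = 0 := by
  constructor
  · intro h e he
    induction e using Sym2.ind with
    | _ i j =>
      simp only [Sym2.mk_isDiag_iff, SimpleGraph.mem_edgeSet, not_or] at he
      exact h i j he.1 he.2
  · intro h i j h1 h2
    exact h s(i, j) (by simp [h1, h2])

theorem mem_modelPerp_iff' [Fintype V] (G : SimpleGraph V) (x : Sym2 V → ℂ) :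
    x ∈ modelPerp G ↔ ∀ e, (e.IsDiag ∨ e ∈ G.edgeSet) → x e = 0 := by
  rw [mem_modelPerp_iff]
  constructor
  · intro h e he
    induction e using Sym2.ind with
    | _ i j =>
      simp only [Sym2.mk_isDiag_iff, SimpleGraph.mem_edgeSet] at he
      exact h i j he
  · intro h i j h1
    exact h s(i, j) (by simpa using h1)

theorem finrank_of_mem_iff_forall_eq_zero {σ : Type*} [Fintype σ] (D : σ → Prop) [DecidablePred D]
    (W : Submodule ℂ (σ → ℂ)) (hW : ∀ x, x ∈ W ↔ ∀ e, ¬ D e → x e = 0) :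
    Module.finrank ℂ W = Fintype.card {e // D e} := by
  classical
  have e : W = ⨅ i ∈ {e | ¬ D e}, LinearMap.ker (LinearMap.proj i : (σ → ℂ) →ₗ[ℂ] ℂ) := by
    ext x
    simp [hW]
  rw [e, (LinearMap.iInfKerProjEquiv ℂ (fun _ : σ => ℂ) (I := {e | D e}) (J := {e | ¬ D e})
    (by rw [Set.disjoint_left]; simp)
    (by intro x _; by_cases h : D x <;> simp [h])).finrank_eq]
  exact Module.finrank_fintype_fun_eq_card ℂ

variable [Fintype V]

theorem finrank_modelSpace (G : SimpleGraph V) [DecidableEq V] [DecidableRel G.Adj] :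
    Module.finrank ℂ (modelSpace G) = Fintype.card V + G.edgeFinset.card := by
  classical
  rw [finrank_of_mem_iff_forall_eq_zero (fun e => e.IsDiag ∨ e ∈ G.edgeSet) _
    (mem_modelSpace_iff G), Fintype.card_subtype_or_disjoint, Sym2.card_subtype_diag]
  · congr 1
    rw [← SimpleGraph.card_edgeSet]
  · rw [Pi.disjoint_iff]
    intro e
    rw [Prop.disjoint_iff]
    exact fun h => G.not_isDiag_of_mem_edgeSet h.2 h.1

theorem finrank_modelSpace_add_finrank_modelPerp (G : SimpleGraph V) :
    Module.finrank ℂ (modelSpace G) + Module.finrank ℂ (modelPerp G)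
      = Fintype.card (Sym2 V) := by
  classical
  rw [finrank_of_mem_iff_forall_eq_zero (fun e => e.IsDiag ∨ e ∈ G.edgeSet) _
    (mem_modelSpace_iff G),
    finrank_of_mem_iff_forall_eq_zero (fun e => ¬ (e.IsDiag ∨ e ∈ G.edgeSet)) (modelPerp G)
    (by simpa only [not_not] using mem_modelPerp_iff' G),
    Fintype.card_subtype_compl]
  exact Nat.add_sub_of_le (Fintype.card_subtype_le _)

variable [DecidableEq V]

theorem mem_identitySlice_iff (G : SimpleGraph V) (x : Sym2 V → ℂ) :
    x ∈ identitySlice G ↔ ∀ i j, (i = j ∨ G.Adj i j) → x s(i, j) = (1 : Matrix V V ℂ) i j := by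
  constructor
  · rintro ⟨y, hy, hxy⟩ i j hij
    have h1 := congrFun (congrFun hxy i) j
    have h2 := (mem_modelPerp_iff G y).mp hy i j hij
    rw [Matrix.add_apply, h2, add_zero] at h1
    exact h1
  · intro h
    obtain ⟨y, hy, -⟩ := existsUnique_symMatrix (symMatrix x - 1)
      ((symMatrix_isSymm x).sub Matrix.isSymm_one)
    refine ⟨y, (mem_modelPerp_iff G y).mpr fun i j hij => ?_, by rw [hy]; abel⟩
    rw [hy, Matrix.sub_apply, symMatrix_apply, h i j hij, sub_self]

theorem modelPerp_le_zariskiTangentSpace (G : SimpleGraph V) {x : Sym2 V → ℂ}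
    (hx : x ∈ identitySlice G) : modelPerp G ≤ zariskiTangentSpace (sliceIdeal G) x := by
  intro v hv
  have h := mem_zariskiTangentSpace_of_hasDerivAt (S := identitySlice G)
    (γ := fun t e => x e + t * v e) (v := v) (s := 0)
    (fun e => by simpa using ((hasDerivAt_id (0 : ℂ)).mul_const (v e)).const_add (x e))
    (Filter.Eventually.of_forall fun t => by
      rw [mem_identitySlice_iff] at hx ⊢
      intro i j hij
      have h2 := (mem_modelPerp_iff G v).mp hv i j hij
      rw [symMatrix_apply] at h2
      rw [h2, mul_zero, add_zero, hx i j hij])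
  simp only [zero_mul, add_zero] at h
  exact h

theorem zariskiTangentSpace_sliceIdeal (G : SimpleGraph V) {x : Sym2 V → ℂ}
    (hx : x ∈ identitySlice G) : zariskiTangentSpace (sliceIdeal G) x = modelPerp G := by
  refine le_antisymm (fun v hv => ?_) (modelPerp_le_zariskiTangentSpace G hx)
  rw [mem_modelPerp_iff]
  intro i j hij
  have h := hv (X s(i, j) - C (x s(i, j))) (by
    intro y hy
    rw [mem_identitySlice_iff] at hx hy
    simp [hx i j hij, hy i j hij])
  rw [gradientAt_X_sub_C] at h
  simpa [Pi.single_apply, symMatrix_apply] using h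

/-! ### Differentiating matrix inversion -/

section

attribute [local instance] Matrix.linftyOpNormedRing Matrix.linftyOpNormedAlgebra

theorem hasDerivAt_matrix_inv_apply (K M : Matrix V V ℂ) (hK : IsUnit K.det) (i j : V) :
    HasDerivAt (fun t : ℂ => (K + t • M)⁻¹ i j) ((-(K⁻¹ * M * K⁻¹)) i j) 0 := by
  obtain ⟨u, rfl⟩ := (Matrix.isUnit_iff_isUnit_det K).mpr hK
  have h0 : HasDerivAt (fun t : ℂ => (u : Matrix V V ℂ) + t • M) M 0 := by
    have := ((hasDerivAt_id (0 : ℂ)).smul_const M).const_add (u : Matrix V V ℂ)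
    rw [one_smul] at this
    exact this
  have h1 : HasFDerivAt Ring.inverse
      (-ContinuousLinearMap.mulLeftRight ℂ (Matrix V V ℂ) ↑u⁻¹ ↑u⁻¹)
      ((u : Matrix V V ℂ) + (0 : ℂ) • M) := by
    simpa using hasFDerivAt_ringInverse (𝕜 := ℂ) u
  have h2 := h1.comp_hasDerivAt (0 : ℂ) h0
  have h3 := (LinearMap.toContinuousLinearMap
    (Matrix.entryLinearMap ℂ ℂ i j)).hasFDerivAt.comp_hasDerivAt (0 : ℂ) h2
  have e : (fun t : ℂ => ((u : Matrix V V ℂ) + t • M)⁻¹ i j) =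
      fun t : ℂ => Ring.inverse ((u : Matrix V V ℂ) + t • M) i j := by
    simp only [Matrix.nonsing_inv_eq_ringInverse]
  rw [e, ← Matrix.coe_units_inv]
  exact h3

theorem eventually_isUnit_det_add_smul (K M : Matrix V V ℂ) (hK : IsUnit K.det) :
    ∀ᶠ t : ℂ in nhds 0, IsUnit (K + t • M).det := by
  have hc : Continuous fun t : ℂ => (K + t • M).det := by fun_prop
  have h0 : (K + (0 : ℂ) • M).det ≠ 0 := by simpa using hK.ne_zero
  filter_upwards [hc.continuousAt.eventually_ne h0] with t ht
  exact isUnit_iff_ne_zero.mpr ht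

end

/-- The velocities `-K⁻¹ M K⁻¹` of the curves `(K + tM)⁻¹`, for `M` in the model space, are tangent,
and they determine `M`. -/
theorem finrank_modelSpace_le_of_mem_inverseSet (G : SimpleGraph V) {x : Sym2 V → ℂ}
    (hx : x ∈ inverseSet G) :
    Module.finrank ℂ (modelSpace G) ≤ Module.finrank ℂ (zariskiTangentSpace (inverseIdeal G) x) := by
  obtain ⟨k, hk, hdet, hxk⟩ := hx
  have hadd : ∀ (m : Sym2 V → ℂ) (t : ℂ), symMatrix (k + t • m) = symMatrix k + t • symMatrix m :=
    fun _ _ => rfl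
  let φ : (Sym2 V → ℂ) →ₗ[ℂ] (Sym2 V → ℂ) :=
    { toFun := fun m => symCoord (-(symMatrix x * symMatrix m * symMatrix x))
      map_add' := fun m m' => by
        have : symMatrix (m + m') = symMatrix m + symMatrix m' := rfl
        rw [this, Matrix.mul_add, Matrix.add_mul, neg_add, map_add]
      map_smul' := fun c m => by
        have : symMatrix (c • m) = c • symMatrix m := rfl
        rw [this, Matrix.mul_smul, Matrix.smul_mul, ← smul_neg, map_smul, RingHom.id_apply] }
  have hsymm : ∀ m, (-(symMatrix x * symMatrix m * symMatrix x)).IsSymm := by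
    intro m
    rw [Matrix.IsSymm, Matrix.transpose_neg, Matrix.transpose_mul, Matrix.transpose_mul,
      (symMatrix_isSymm x).eq, (symMatrix_isSymm m).eq, Matrix.mul_assoc]
  have hφ : Function.Injective φ := by
    rw [← LinearMap.ker_eq_bot, LinearMap.ker_eq_bot']
    intro m hm
    have h1 := congrArg symMatrix hm
    change symMatrix (symCoord (-(symMatrix x * symMatrix m * symMatrix x))) = 0 at h1
    rw [symMatrix_symCoord (hsymm m), neg_eq_zero, hxk] at h1
    have h2 : symMatrix m = 0 := by
      calc symMatrix m = symMatrix k * ((symMatrix k)⁻¹ * symMatrix m * (symMatrix k)⁻¹)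
            * symMatrix k := by
            rw [Matrix.mul_assoc, Matrix.mul_assoc _ _ (symMatrix k), Matrix.nonsing_inv_mul _ hdet,
              Matrix.mul_one, ← Matrix.mul_assoc, Matrix.mul_nonsing_inv _ hdet, Matrix.one_mul]
        _ = 0 := by rw [h1]; simp
    funext e
    induction e using Sym2.ind with
    | _ i j => exact congrFun (congrFun h2 i) j
  have hle : (modelSpace G).map φ ≤ zariskiTangentSpace (inverseIdeal G) x := by
    rintro _ ⟨m, hm, rfl⟩
    have h := mem_zariskiTangentSpace_of_hasDerivAt (S := inverseSet G)
      (γ := fun t => symCoord (symMatrix k + t • symMatrix m)⁻¹) (v := φ m) (s := 0)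
      (fun e => by
        have := hasDerivAt_matrix_inv_apply (symMatrix k) (symMatrix m) hdet (Quot.out e).1
          (Quot.out e).2
        rw [← hxk] at this
        exact this)
      (by
        filter_upwards [eventually_isUnit_det_add_smul _ (symMatrix m) hdet] with t ht
        refine ⟨k + t • m, add_mem hk (Submodule.smul_mem _ _ hm), ht, ?_⟩
        rw [symMatrix_symCoord, hadd]
        rw [Matrix.IsSymm, Matrix.transpose_nonsing_inv, ← hadd, (symMatrix_isSymm _).eq])
    have h0 : symCoord (symMatrix k + (0 : ℂ) • symMatrix m)⁻¹ = x := by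
      rw [zero_smul, add_zero, ← hxk]
      funext e
      induction e using Sym2.ind with
      | _ i j =>
        exact congrFun (congrFun (symMatrix_symCoord (symMatrix_isSymm x)) i) j
    rw [h0] at h
    exact h
  calc Module.finrank ℂ (modelSpace G) = Module.finrank ℂ ((modelSpace G).map φ) :=
        ((Submodule.equivMapOfInjective φ hφ _).finrank_eq)
    _ ≤ _ := Submodule.finrank_mono hle

theorem finrank_modelSpace_le (G : SimpleGraph V) {x : Sym2 V → ℂ} (hx : x ∈ inverseVariety G) :
    Module.finrank ℂ (modelSpace G) ≤ Module.finrank ℂ (zariskiTangentSpace (inverseIdeal G) x) := by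
  obtain ⟨y, hy, hle⟩ := exists_finrank_zariskiTangentSpace_le hx
  exact (finrank_modelSpace_le_of_mem_inverseSet G hy).trans hle

/-- Minors of `L_G^{-1}` that vanish: the rows contain a vertex and all its neighbours, the columns
avoid the vertex. -/
theorem minor_mem_inverseIdeal (G : SimpleGraph V) {ι : Type*} [Fintype ι] [DecidableEq ι] (u : V)
    (r c : ι → V) (hr : Function.Injective r) (hu : ∀ w, w = u ∨ G.Adj u w → w ∈ Set.range r)
    (hc : ∀ p, c p ≠ u) :
    (Matrix.of fun p q => (X s(r p, c q) : MvPolynomial (Sym2 V) ℂ)).det ∈ inverseIdeal G := by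
  rintro x ⟨k, hk, hdet, hxk⟩
  have hsum : ∀ v, ∑ p, symMatrix k u (r p) * x s(r p, v) = (1 : Matrix V V ℂ) u v := by
    intro v
    rw [← Matrix.mul_nonsing_inv _ hdet, ← hxk, Matrix.mul_apply]
    refine Fintype.sum_of_injective r hr _ _ (fun w hw => ?_) (fun p => rfl)
    have h := not_or.mp fun h => hw (hu w h)
    rw [hk u w (Ne.symm h.1) h.2, zero_mul]
  rw [AlgHom.map_det]
  -- Row `u` of `K` is a left kernel vector; it is nonzero because it pairs to 1 with column `u` of
  -- the inverse.
  refine Matrix.exists_vecMul_eq_zero_iff.mp ⟨fun p => symMatrix k u (r p), fun h0 => ?_, ?_⟩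
  · have h1 := hsum u
    have h2 : ∀ p, symMatrix k u (r p) = 0 := fun p => congrFun h0 p
    simp [h2] at h1
  · funext q
    have h1 := hsum (c q)
    rw [Matrix.one_apply_ne (hc q).symm] at h1
    simpa [Matrix.vecMul, dotProduct] using h1

end Graph

/-! ### The cycle -/

section Cycle

theorem cycleGraph_adj_ofNat {n : ℕ} [NeZero n] (hn : 3 ≤ n) (i j : ℕ) :
    (SimpleGraph.cycleGraph n).Adj (Fin.ofNat n i) (Fin.ofNat n j) ↔
      j ≡ i + 1 [MOD n] ∨ i ≡ j + 1 [MOD n] := by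
  have key : ∀ i j : ℕ, (Fin.ofNat n i - Fin.ofNat n j).val = 1 ↔ i ≡ j + 1 [MOD n] := by
    intro i j
    have hi := Nat.mod_lt i (by omega : n > 0)
    have hj := Nat.mod_lt j (by omega : n > 0)
    rw [Fin.val_sub, Nat.ModEq, Nat.add_mod j 1, Nat.mod_eq_of_lt (by omega : 1 < n)]
    simp only [Fin.val_ofNat]
    generalize i % n = a at *
    generalize j % n = b at *
    have h1 : (n - b + a) % n = if b ≤ a then a - b else n - b + a := by
      split_ifs with h
      · rw [show n - b + a = (a - b) + n by omega, Nat.add_mod_right, Nat.mod_eq_of_lt (by omega)]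
      · rw [Nat.mod_eq_of_lt (by omega)]
    have h2 : (b + 1) % n = if b + 1 < n then b + 1 else 0 := by
      split_ifs with h
      · rw [Nat.mod_eq_of_lt h]
      · rw [show b + 1 = n by omega, Nat.mod_self]
    rw [h1, h2]
    split_ifs <;> omega
  rw [SimpleGraph.cycleGraph_adj', key, key, or_comm]

theorem ofNat_eq_ofNat_iff {n : ℕ} [NeZero n] (i j : ℕ) :
    Fin.ofNat n i = Fin.ofNat n j ↔ i ≡ j [MOD n] := by
  rw [Fin.ext_iff]
  rfl

theorem ofNat_val {n : ℕ} [NeZero n] (i : Fin n) : Fin.ofNat n i = i := by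
  ext
  simp

/-- A tangent direction common to both varieties gives a cycle array over the dual numbers. -/
theorem isCycleArray_of_mem {n : ℕ} [NeZero n] (hn : 3 ≤ n) {A v : Sym2 (Fin n) → ℂ}
    (hA : A ∈ inverseVariety (SimpleGraph.cycleGraph n))
    (hA' : A ∈ identitySlice (SimpleGraph.cycleGraph n))
    (hv : v ∈ zariskiTangentSpace (inverseIdeal (SimpleGraph.cycleGraph n)) A)
    (hv' : v ∈ modelPerp (SimpleGraph.cycleGraph n)) :
    IsCycleArray n fun i j =>
      (TrivSqZeroExt.inl (A s(Fin.ofNat n i, Fin.ofNat n j)) +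
        TrivSqZeroExt.inr (v s(Fin.ofNat n i, Fin.ofNat n j)) : DualNumber ℂ) := by
  rw [mem_identitySlice_iff] at hA'
  rw [mem_modelPerp_iff] at hv'
  refine ⟨fun i j => by simp only [Sym2.eq_swap], fun i j => ?_, fun i => ?_, fun i => ?_,
    fun i c hc => ?_⟩
  · rw [(ofNat_eq_ofNat_iff (n := n) (i + n) i).mpr (by simp [Nat.ModEq])]
  · have := hv' (Fin.ofNat n i) _ (Or.inl rfl)
    rw [symMatrix_apply] at this
    rw [hA' _ _ (Or.inl rfl), this]
    simp
  · have hadj := (cycleGraph_adj_ofNat hn i (i + 1)).mpr (Or.inl rfl)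
    have := hv' _ _ (Or.inr hadj)
    rw [symMatrix_apply] at this
    rw [hA' _ _ (Or.inr hadj), this, Matrix.one_apply_ne hadj.ne]
    simp
  -- Rows `i, i + 1, i + 2` are the vertex `i + 1` together with both of its neighbours.
  · have hmem := minor_mem_inverseIdeal (SimpleGraph.cycleGraph n) (Fin.ofNat n (i + 1))
      (fun p : Fin 3 => Fin.ofNat n (i + p)) (fun p => Fin.ofNat n (c p)) (fun p q hpq => by
        have h1 := Nat.ModEq.add_left_cancel' i ((ofNat_eq_ofNat_iff _ _).mp hpq)
        have h2 := Nat.ModEq.eq_of_lt_of_lt h1 (by omega) (by omega)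
        exact Fin.ext h2)
      (fun w hw => by
        rw [← ofNat_val w] at hw ⊢
        rw [cycleGraph_adj_ofNat hn, ofNat_eq_ofNat_iff] at hw
        rcases hw with hw | hw | hw
        · exact ⟨1, (ofNat_eq_ofNat_iff _ _).mpr hw.symm⟩
        · exact ⟨2, (ofNat_eq_ofNat_iff _ _).mpr hw.symm⟩
        · exact ⟨0, (ofNat_eq_ofNat_iff _ _).mpr (Nat.ModEq.add_right_cancel' 1 hw)⟩)
      (fun p h => hc p ((ofNat_eq_ofNat_iff _ _).mp h))
    have h0 := aeval_eq_zero_of_mem_zariskiTangentSpace hA hv hmem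
    rw [AlgHom.map_det] at h0
    convert h0 using 2
    ext p q <;> simp

theorem disjoint_zariskiTangentSpace_modelPerp {n : ℕ} (hn : 3 ≤ n) {A : Sym2 (Fin n) → ℂ}
    (hA : A ∈ inverseVariety (SimpleGraph.cycleGraph n))
    (hA' : A ∈ identitySlice (SimpleGraph.cycleGraph n)) :
    Disjoint (zariskiTangentSpace (inverseIdeal (SimpleGraph.cycleGraph n)) A)
      (modelPerp (SimpleGraph.cycleGraph n)) := by
  have : NeZero n := ⟨by omega⟩
  rw [Submodule.disjoint_def]
  intro v hv hv'
  funext e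
  induction e using Sym2.ind with
  | _ i j =>
    -- Shifting by `j` moves column `j` to column 0, where `snd_column` applies at the residue of `i
    -- - j`.
    have h := (isCycleArray_of_mem hn hA hA' hv hv').shift j
    have h1 := h.snd_column hn ((i + (n - j)) % n) (Nat.mod_lt _ (by omega))
    have h2 : Fin.ofNat n ((i + (n - j)) % n + j) = i := by
      conv_rhs => rw [← ofNat_val i]
      rw [ofNat_eq_ofNat_iff, Nat.ModEq, Nat.mod_add_mod, add_assoc,
        Nat.sub_add_cancel j.2.le, Nat.add_mod_right]
    rw [h2, zero_add, ofNat_val] at h1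
    simpa using h1

theorem finrank_modelSpace_cycleGraph {n : ℕ} (hn : 3 ≤ n) :
    Module.finrank ℂ (modelSpace (SimpleGraph.cycleGraph n)) = 2 * n := by
  obtain ⟨m, rfl⟩ := Nat.exists_eq_add_of_le' hn
  have h := (SimpleGraph.cycleGraph (m + 3)).sum_degrees_eq_twice_card_edges
  simp only [SimpleGraph.cycleGraph_degree_three_le, Finset.sum_const, Finset.card_univ,
    Fintype.card_fin, smul_eq_mul] at h
  rw [finrank_modelSpace, Fintype.card_fin]
  omega

end Cycle

end

theorem theorem3p7 (n : ℕ) (hn : 3 ≤ n) (A : Sym2 (Fin n) → ℂ)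
    (hA : A ∈ inverseVariety (SimpleGraph.cycleGraph n) ∩
      identitySlice (SimpleGraph.cycleGraph n)) :
    -- the Jacobian matrix of the intersection at `A` has full rank
    jacobianRowSpace (intersectionIdeal (SimpleGraph.cycleGraph n)) A = ⊤ ∧
    -- `L^{-1}` has a tangent space of the dimension `2 n` of `L^{-1}` at `A`, which is
    -- complementary to the tangent space of `Id + L^⊥`
    Module.finrank ℂ (zariskiTangentSpace (inverseIdeal (SimpleGraph.cycleGraph n)) A) = 2 * n ∧
    IsCompl (zariskiTangentSpace (inverseIdeal (SimpleGraph.cycleGraph n)) A)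
      (zariskiTangentSpace (sliceIdeal (SimpleGraph.cycleGraph n)) A) ∧
    -- `A` is a reduced, isolated point of the scheme-theoretic intersection
    IsReduced (schemeLocalRing (intersectionIdeal (SimpleGraph.cycleGraph n)) A) ∧
    IsZariskiIsolated (inverseVariety (SimpleGraph.cycleGraph n) ∩
      identitySlice (SimpleGraph.cycleGraph n)) A := by
  set G := SimpleGraph.cycleGraph n with hG
  have hdisj : Disjoint (zariskiTangentSpace (inverseIdeal G) A) (modelPerp G) :=
    disjoint_zariskiTangentSpace_modelPerp hn hA.1 hA.2
  have hslice := zariskiTangentSpace_sliceIdeal G hA.2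
  have hjac : jacobianRowSpace (intersectionIdeal G) A = ⊤ := by
    apply jacobianRowSpace_eq_top
    rw [intersectionIdeal, zariskiTangentSpace_sup, hslice, hdisj.eq_bot]
  have hZ : inverseVariety G ∩ identitySlice G ⊆ zeroLocus ℂ (intersectionIdeal G) := by
    rintro y ⟨hy1, hy2⟩ f hf
    obtain ⟨g, hg, k, hk, rfl⟩ := Submodule.mem_sup.mp hf
    rw [map_add, hy1 g hg, hk y hy2, add_zero]
  have hle : intersectionIdeal G ≤ vanishingIdeal ℂ {A} := fun f hf =>
    (mem_vanishingIdeal_singleton_iff A f).mpr (hZ hA f hf)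
  have h1 := finrank_modelSpace_le G hA.1
  have h2 := finrank_modelSpace_add_finrank_modelPerp G
  have h3 : Module.finrank ℂ (modelSpace G) = 2 * n := finrank_modelSpace_cycleGraph hn
  -- This upper bound meets the lower bound `h1`: the tangent space has dimension exactly `2n`, and
  -- the direct sum fills the whole space.
  have h4 := Submodule.finrank_add_finrank_le_of_disjoint hdisj
  rw [Module.finrank_fintype_fun_eq_card] at h4
  refine ⟨hjac, by omega, ?_, isReduced_schemeLocalRing hle hjac,
    isZariskiIsolated_of_jacobianRowSpace hA hZ hjac⟩
  rw [hslice]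
  refine ⟨hdisj, codisjoint_iff.mpr (Submodule.eq_top_of_finrank_eq ?_)⟩
  have h5 := Submodule.finrank_sup_add_finrank_inf_eq (zariskiTangentSpace (inverseIdeal G) A)
    (modelPerp G)
  rw [hdisj.eq_bot, finrank_bot] at h5
  rw [Module.finrank_fintype_fun_eq_card]
  omega
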